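/- Let $d,m\ge 1$ be integers, let $p\in[0,1]$ and $\sigma\ge 0$. Let $A_1,\dots,A_m\in\mathbb{R}^{d\times d}$ be random matrices all of whose entries are i.i.d. standard Gaussian, and let $s_1,\dots,s_m$ be i.i.d. random variables, independent of the $A_i$, where $s_i\sim N(0,\sigma^2)$ with probability $p$ and $s_i=0$ with probability $1-p$. Write $\langle X,Y\rangle=\mathrm{Tr}(X^\top Y)$, let $\|\cdot\|_F$ be the Frobenius norm, put $\mathbb{S}=\{X\in\mathbb{R}^{d\times d}:\|X\|_F=1\}$ and $$\mathcal{A}(M)=(\langle A_1,M\rangle,\dots,\langle A_m,M\rangle)^\top,\qquad Q(M)=\frac1m\sum_{i=1}^m\bigl(\langle A_i,M\rangle+s_i\bigr)A_i .$$ The operator $\mathcal{A}$ satisfies $\ell_2$-RIP with parameters $(r,\delta)$ if $(1-\delta)\|M\|_F^2\le\frac1m\|\mathcal{A}(M)\|^2\le(1+\delta)\|M\|_F^2$ for every $M\in\mathbb{R}^{d\times d}$ of rank at most $r$. There are universal constants $C_0,C_1,c_1,c_2>0$ (independent of $d,m,p,\sigma,\delta$) such that the following hold. 1. For every $\delta\in(0,1)$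 with $m\ge C_0\,d^2/\delta^2$, the operator $\mathcal{A}$ satisfies $\ell_2$-RIP with parameters $(d,\delta)$ with probability at least $1-C_1e^{-c_1m\delta^2}$. 2. If $pm\ge1$ or $p\sigma^2\le 1$, then $$\mathbb{P}\left(\sup_{X\in\mathbb{S}}\|Q(X)-X\|_F\ \ge\ c_2\sqrt{\frac{(1+p\sigma^2)d^2}{m}}\right)\ge\frac12 .$$ -/

import Mathlib

open MeasureTheory ProbabilityTheory
open scoped Matrix.Norms.Frobenius

/-- The trace inner product `⟨X, Y⟩ = Tr(Xᵀ Y)` of two real square matrices. -/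
def matInner {d : ℕ} (X Y : Matrix (Fin d) (Fin d) ℝ) : ℝ :=
  (X.transpose * Y).trace

/-- The unit rank-`r` sphere `{X : ‖X‖_F = 1, rank X ≤ r}` in the space of `d × d` matrices.
The norm on matrices is Mathlib's Frobenius norm throughout. -/
def unitRankSphere (d r : ℕ) : Set (Matrix (Fin d) (Fin d) ℝ) :=
  {X | ‖X‖ = 1 ∧ X.rank ≤ r}

/-- The linear measurement operator `M ↦ (⟨A₁, M⟩, …, ⟨Aₘ, M⟩)`. -/
def measurementOp {d m : ℕ} (A : Fin m → Matrix (Fin d) (Fin d) ℝ)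
    (M : Matrix (Fin d) (Fin d) ℝ) : EuclideanSpace ℝ (Fin m) :=
  WithLp.toLp 2 (fun i => matInner (A i) M)

/-- `ℓ₂`-RIP with parameters `(r, δ)`: the operator is nearly norm preserving on all matrices of
rank at most `r`. -/
def L2RIP {d m : ℕ} (A : Fin m → Matrix (Fin d) (Fin d) ℝ) (r : ℕ) (δ : ℝ) : Prop :=
  ∀ M : Matrix (Fin d) (Fin d) ℝ, M.rank ≤ r →
    (1 - δ) * ‖M‖ ^ 2 ≤ (1 / (m : ℝ)) * ‖measurementOp A M‖ ^ 2 ∧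
      (1 / (m : ℝ)) * ‖measurementOp A M‖ ^ 2 ≤ (1 + δ) * ‖M‖ ^ 2

/-- The noisy gradient map `Q(M) = (1/m) ∑ᵢ (⟨Aᵢ, M⟩ + sᵢ) Aᵢ`. -/
noncomputable def noisyGradientMap {d m : ℕ} (A : Fin m → Matrix (Fin d) (Fin d) ℝ)
    (s : Fin m → ℝ) (M : Matrix (Fin d) (Fin d) ℝ) : Matrix (Fin d) (Fin d) ℝ :=
  (1 / (m : ℝ)) • ∑ i, (matInner (A i) M + s i) • A i

/-- The law of a single noise variable: `N(0, σ²)` with probability `p` and `0` with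
probability `1 - p`. -/
noncomputable def noiseLaw (p σ : ℝ) : Measure ℝ :=
  ENNReal.ofReal p • gaussianReal 0 (Real.toNNReal (σ ^ 2)) +
    ENNReal.ofReal (1 - p) • Measure.dirac 0

/-- All entries of the random matrices `A₁, …, Aₘ` are standard Gaussian, every noise variable
`sᵢ` has the law `noiseLaw p σ`, and all these real random variables (the `m * d * d` entries and
the `m` noise variables) are mutually independent. -/
structure GaussianNoisyModel {Ω : Type*} [MeasurableSpace Ω] (P : Measure Ω) {d m : ℕ} (p σ : ℝ)
    (A : Fin m → Ω → Matrix (Fin d) (Fin d) ℝ) (s : Fin m → Ω → ℝ) : Prop where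
  entry_law : ∀ i j k, HasLaw (fun ω => A i ω j k) (gaussianReal 0 1) P
  noise_law : ∀ i, HasLaw (s i) (noiseLaw p σ) P
  indep : iIndepFun
    (Sum.elim (fun (q : Fin m × Fin d × Fin d) (ω : Ω) => A q.1 ω q.2.1 q.2.2) s) P

/-!
Both claims reduce to tail bounds for sums of squares of independent centred Gaussian variables,
because for a fixed vector `u` the combinations `∑ᵢ uᵢ Gₖᵢ` of a standard Gaussian array `G` are
independent `N(0, ‖u‖²)` variables (`iIndepFun_sum_mul_gaussian`).

*Restricted isometry.* For a fixed unit matrix `M`, `‖𝒜(M)‖²` is chi-squared with `m` degrees of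
freedom and concentrates at scale `m δ` with probability `1 - 2 exp(-c m δ²)`
(`measureReal_chiSq_deviation_le`). The quadratic form `‖𝒜(M)‖² / m - ‖M‖²` is controlled by its
values on a `1/2`-net of the unit sphere (`abs_quadratic_le_of_net`), which has at most `5 ^ (d²)`
points (`exists_finset_net_unitSphere`). The union bound is affordable since `m δ² ≥ C₀ d²`.

*Lower bound.* At `±X` the error of the noisy gradient map is `±L + N`, where `L` is the noiseless
error at `X` and `N = (1/m) ∑ᵢ sᵢ Aᵢ`, so that the supremum is at least `max ‖L‖ ‖N‖`
(`norm_noise_le_iSup_and_norm_noiseless_le_iSup`). All events below have to hold with probability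
`1/2`, so second-moment arguments such as the Paley-Zygmund inequality are not enough; the
small-ball bounds come from Laplace transforms at a large negative argument.

* If `p σ² > 1`, then `p m ≥ 1`, and `N` is used. The vector `s` satisfies `‖s‖² ≥ c p m σ²` with
  probability at least `11/20` (`measureReal_sum_sq_noise_le`), and given `s` the entries of `m N`
  are independent `N(0, ‖s‖²)` variables (`measureReal_sum_sq_sum_mul_gaussian_le`).
* If `p σ² ≤ 1` and `d ≥ 2`, then `L` is used at a matrix unit. Its entries at the other `d² - 1`
  positions are correlations of independent Gaussian vectors, and are treated as in the first case.
* If `p σ² ≤ 1` and `d = 1`, then `|L| = |χ²ₘ - m| / m`, and what is needed is that `χ²ₘ` does not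
  concentrate near `m` at a scale smaller than `√m`, uniformly in `m`
  (`exists_chiSq_anticoncentration`). The central limit theorem gives this for all large `m`, and
  the finitely many others are handled by the absence of atoms.
-/

/-! ### The Laplace transform of the square of a Gaussian variable -/

lemma integral_exp_mul_sq_gaussianReal {v : NNReal} {t : ℝ} (h : 2 * t * v < 1) :
    ∫ x, Real.exp (t * x ^ 2) ∂(gaussianReal 0 v) = (√(1 - 2 * t * v))⁻¹ := by
  rcases eq_or_ne v 0 with rfl | hv
  · simp [gaussianReal_zero_var]
  have hv' : (0 : ℝ) < v := by positivity
  have hb : 0 < (1 - 2 * t * v) / (2 * v) := by apply div_pos <;> linarith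
  rw [integral_gaussianReal_eq_integral_smul hv]
  have key : ∀ x : ℝ, gaussianPDFReal 0 v x • Real.exp (t * x ^ 2) =
      (√(2 * Real.pi * v))⁻¹ * Real.exp (-((1 - 2 * t * v) / (2 * v)) * x ^ 2) := by
    intro x
    rw [gaussianPDFReal, smul_eq_mul, mul_assoc, ← Real.exp_add]
    congr 2
    field_simp
    ring
  simp_rw [key]
  rw [integral_const_mul, integral_gaussian, ← Real.sqrt_inv, ← Real.sqrt_inv,
    ← Real.sqrt_mul (by positivity)]
  congr 1
  have : 1 - 2 * t * v ≠ 0 := by linarith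
  have := Real.pi_pos
  field_simp

lemma integrable_exp_mul_sq_gaussianReal {v : NNReal} {t : ℝ} (h : 2 * t * v < 1) :
    Integrable (fun x : ℝ => Real.exp (t * x ^ 2)) (gaussianReal 0 v) := by
  -- a non-integrable function has Bochner integral zero
  by_contra hn
  have := integral_exp_mul_sq_gaussianReal h
  rw [integral_undef hn] at this
  have h2 : 0 < (√(1 - 2 * t * v))⁻¹ := by
    rw [inv_pos, Real.sqrt_pos]
    linarith
  linarith

lemma integral_exp_mul_sq_noiseLaw {p σ t : ℝ} (hp : 0 ≤ p) (hp1 : p ≤ 1)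
    (h : 2 * t * σ ^ 2 < 1) :
    Integrable (fun x : ℝ => Real.exp (t * x ^ 2)) (noiseLaw p σ) ∧
    ∫ x, Real.exp (t * x ^ 2) ∂(noiseLaw p σ) = p * (√(1 - 2 * t * σ ^ 2))⁻¹ + (1 - p) := by
  have h' : 2 * t * (Real.toNNReal (σ ^ 2) : ℝ) < 1 := by
    rwa [Real.coe_toNNReal _ (sq_nonneg σ)]
  have i1 : Integrable (fun x : ℝ => Real.exp (t * x ^ 2))
      (ENNReal.ofReal p • gaussianReal 0 (Real.toNNReal (σ ^ 2))) :=
    (integrable_exp_mul_sq_gaussianReal h').smul_measure (by simp)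
  have i2 : Integrable (fun x : ℝ => Real.exp (t * x ^ 2))
      (ENNReal.ofReal (1 - p) • Measure.dirac (0 : ℝ)) :=
    (integrable_dirac (by simp)).smul_measure (by simp)
  refine ⟨i1.add_measure i2, ?_⟩
  rw [noiseLaw, integral_add_measure i1 i2, integral_smul_measure, integral_smul_measure,
    integral_exp_mul_sq_gaussianReal h', integral_dirac, ENNReal.toReal_ofReal hp,
    ENNReal.toReal_ofReal (by linarith), Real.coe_toNNReal _ (sq_nonneg σ)]
  simp

/-! ### Chernoff bounds for sums of independent variables -/

section Chernoff

variable {Ω κ : Type*} [MeasurableSpace Ω] [Fintype κ] {P : Measure Ω} [IsProbabilityMeasure P]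

/-- The Laplace transform of a sum of squares of independent variables with law `μ`. -/
lemma mgf_sum_sq_of_hasLaw {μ : Measure ℝ} {Z : κ → Ω → ℝ} (hZ : ∀ k, HasLaw (Z k) μ P)
    (hi : iIndepFun Z P) {t : ℝ} (ht : Integrable (fun x : ℝ => Real.exp (t * x ^ 2)) μ) :
    Integrable (fun ω => Real.exp (t * ∑ k, Z k ω ^ 2)) P ∧
    mgf (fun ω => ∑ k, Z k ω ^ 2) P t =
      (∫ x, Real.exp (t * x ^ 2) ∂μ) ^ Fintype.card κ := by
  have hi2 : iIndepFun (fun k ω => Z k ω ^ 2) P :=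
    hi.comp (fun _ x => x ^ 2) (fun _ => by fun_prop)
  have hm : ∀ k, AEMeasurable (fun ω => Z k ω ^ 2) P :=
    fun k => (hZ k).aemeasurable.pow_const 2
  have hk : ∀ k, mgf (fun ω => Z k ω ^ 2) P t = ∫ x, Real.exp (t * x ^ 2) ∂μ := fun k =>
    (hZ k).integral_comp (f := fun x : ℝ => Real.exp (t * x ^ 2))
      (by fun_prop)
  have hs : (fun ω => ∑ k, Z k ω ^ 2) = ∑ k, fun ω => Z k ω ^ 2 := by
    ext ω; simp
  have hmgf : mgf (fun ω => ∑ k, Z k ω ^ 2) P t =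
      (∫ x, Real.exp (t * x ^ 2) ∂μ) ^ Fintype.card κ := by
    rw [hs, hi2.mgf_sum₀ hm]
    simp [hk]
  refine ⟨?_, hmgf⟩
  by_contra hn
  -- otherwise the moment generating function takes the junk value zero
  rw [mgf_undef hn] at hmgf
  have : NeZero μ := by
    refine ⟨fun h0 => ?_⟩
    subst h0
    rcases isEmpty_or_nonempty κ with h | ⟨⟨k⟩⟩
    · simp at hn
    · have := (hZ k).isProbabilityMeasure_iff.1 ‹_›
      exact IsProbabilityMeasure.ne_zero (0 : Measure ℝ) rfl
  have : 0 < ∫ x, Real.exp (t * x ^ 2) ∂μ := integral_exp_pos ht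
  exact absurd hmgf (by positivity)

/-- A sum of squares of independent `N(0, v)` variables is rarely below `1/2000` of its mean, with
a failure probability that is uniform in the number of summands. -/
lemma measureReal_sum_sq_gaussian_le [Nonempty κ] {v : NNReal} (hv : v ≠ 0) {Z : κ → Ω → ℝ}
    (hZ : ∀ k, HasLaw (Z k) (gaussianReal 0 v) P) (hi : iIndepFun Z P) :
    P.real {ω | ∑ k, Z k ω ^ 2 ≤ (1 / 2000) * Fintype.card κ * v} ≤ 1 / 20 := by
  -- the exponent `t = -2000 / v` makes the bound per summand `e / √4001 ≤ 1 / 20`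
  have hv' : (0 : ℝ) < v := by positivity
  have hvt : 1 - 2 * (-(2000 / (v : ℝ))) * v = 4001 := by
    field_simp
    norm_num
  have ht : 2 * (-(2000 / (v : ℝ))) * v < 1 := by linarith
  obtain ⟨h1, h2⟩ := mgf_sum_sq_of_hasLaw hZ hi (integrable_exp_mul_sq_gaussianReal ht)
  have h3 := measure_le_le_exp_mul_mgf (X := fun ω => ∑ k, Z k ω ^ 2) (μ := P)
    ((1 / 2000) * Fintype.card κ * v) (t := -(2000 / (v : ℝ)))
    (by rw [neg_nonpos]; positivity) h1
  refine h3.trans ?_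
  rw [h2, integral_exp_mul_sq_gaussianReal ht, hvt]
  have e1 : -(-(2000 / (v : ℝ))) * ((1 / 2000) * Fintype.card κ * v) = Fintype.card κ * 1 := by
    field_simp
  rw [e1, Real.exp_nat_mul, ← mul_pow]
  have hs : (60 : ℝ) ≤ √4001 := Real.le_sqrt_of_sq_le (by norm_num)
  have hb : Real.exp 1 * (√4001)⁻¹ ≤ 1 / 20 := by
    rw [← div_eq_mul_inv, div_le_iff₀ (by linarith)]
    have := Real.exp_one_lt_three
    linarith
  calc (Real.exp 1 * (√4001)⁻¹) ^ Fintype.card κ ≤ (Real.exp 1 * (√4001)⁻¹) ^ 1 :=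
        pow_le_pow_of_le_one (by positivity) (by linarith) Fintype.card_pos
    _ ≤ 1 / 20 := by simpa using hb

/-- When `p * m ≥ 1`, the squared norm of the noise vector is a constant fraction of its mean, with
probability at least `11/20`. The noise vanishes altogether with probability up to `1/e`. -/
lemma measureReal_sum_sq_noise_le {p σ : ℝ} (hp : 0 ≤ p) (hp1 : p ≤ 1) (hσ : 0 < σ)
    (hpm : 1 ≤ p * Fintype.card κ) {s : κ → Ω → ℝ}
    (hs : ∀ k, HasLaw (s k) (noiseLaw p σ) P) (hi : iIndepFun s P) :
    P.real {ω | ∑ k, s k ω ^ 2 ≤ (1 / 20000) * (p * Fintype.card κ) * σ ^ 2} ≤ 9 / 20 := by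
  have hvt : 1 - 2 * (-(2000 / σ ^ 2)) * σ ^ 2 = 4001 := by
    field_simp
    norm_num
  have ht : 2 * (-(2000 / σ ^ 2)) * σ ^ 2 < 1 := by linarith
  obtain ⟨h0, h0'⟩ := integral_exp_mul_sq_noiseLaw hp hp1 ht
  obtain ⟨h1, h2⟩ := mgf_sum_sq_of_hasLaw hs hi h0
  have h3 := measure_le_le_exp_mul_mgf (X := fun ω => ∑ k, s k ω ^ 2) (μ := P)
    ((1 / 20000) * (p * Fintype.card κ) * σ ^ 2) (t := -(2000 / σ ^ 2))
    (by rw [neg_nonpos]; positivity) h1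
  refine h3.trans ?_
  rw [h2, h0', hvt]
  have hsq : (60 : ℝ) ≤ √4001 := Real.le_sqrt_of_sq_le (by norm_num)
  have hinv : (√4001)⁻¹ ≤ 1 / 60 := by
    rw [inv_eq_one_div]
    exact one_div_le_one_div_of_le (by norm_num) hsq
  have e1 : -(-(2000 / σ ^ 2)) * ((1 / 20000) * (p * Fintype.card κ) * σ ^ 2) =
      1 / 10 * (p * Fintype.card κ) := by
    field_simp
    ring
  have hbase : p * (√4001)⁻¹ + (1 - p) ≤ Real.exp (-(59 / 60 * p)) := by
    have := Real.add_one_le_exp (-(59 / 60 * p))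
    nlinarith
  have hpos : 0 ≤ p * (√4001)⁻¹ + (1 - p) := by
    have : 0 ≤ p * (√4001)⁻¹ := by positivity
    linarith
  rw [e1]
  calc Real.exp (1 / 10 * (p * Fintype.card κ)) * (p * (√4001)⁻¹ + (1 - p)) ^ Fintype.card κ
      ≤ Real.exp (1 / 10 * (p * Fintype.card κ)) *
          Real.exp (-(59 / 60 * p)) ^ Fintype.card κ := by gcongr
    _ = Real.exp (-(53 / 60 * (p * Fintype.card κ))) := by
        rw [← Real.exp_nat_mul, ← Real.exp_add]
        congr 1
        ring
    _ ≤ Real.exp (-(53 / 60)) := by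
        apply Real.exp_le_exp.2
        linarith
    _ ≤ 9 / 20 := by
        rw [Real.exp_neg]
        have : 20 / 9 ≤ Real.exp (53 / 60) := by
          have := Real.quadratic_le_exp_of_nonneg (show (0 : ℝ) ≤ 53 / 60 by norm_num)
          norm_num at this ⊢
          linarith
        rw [inv_le_comm₀ (by positivity) (by norm_num)]
        norm_num at this ⊢
        exact this

lemma one_le_one_sub_mul_exp {x : ℝ} (hx : |x| ≤ 1 / 4) :
    1 ≤ (1 - x) * Real.exp (x + x ^ 2) := by
  obtain ⟨h1, h2⟩ := abs_le.1 hx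
  rcases le_total 0 x with h | h
  · have h3 := Real.quadratic_le_exp_of_nonneg (show 0 ≤ x + x ^ 2 by positivity)
    calc 1 ≤ (1 - x) * (1 + (x + x ^ 2) + (x + x ^ 2) ^ 2 / 2) := by
          have hx' : 0 ≤ 1 / 4 - x := by linarith
          nlinarith [sq_nonneg x, pow_nonneg h 3, mul_nonneg (sq_nonneg x) hx',
            mul_nonneg (pow_nonneg h 3) hx', mul_nonneg (pow_nonneg h 4) hx']
      _ ≤ _ := mul_le_mul_of_nonneg_left h3 (by linarith)
  · have h3 := Real.add_one_le_exp (x + x ^ 2)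
    calc 1 ≤ (1 - x) * (x + x ^ 2 + 1) := by nlinarith [sq_nonneg x]
      _ ≤ _ := mul_le_mul_of_nonneg_left h3 (by linarith)

/-- Near zero, the Laplace transform of `x ^ 2` under `N(0, 1)` is at most `exp (t + 2 t²)`. -/
lemma inv_sqrt_one_sub_le_exp {t : ℝ} (ht : |t| ≤ 1 / 8) :
    (√(1 - 2 * t * (1 : NNReal)))⁻¹ ≤ Real.exp (t + 2 * t ^ 2) := by
  obtain ⟨h1, h2⟩ := abs_le.1 ht
  have hx := one_le_one_sub_mul_exp (x := 2 * t) (by rw [abs_mul, abs_two]; linarith)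
  have hpos : (0 : ℝ) < 1 - 2 * t := by linarith
  rw [NNReal.coe_one, mul_one, inv_le_iff_one_le_mul₀ (Real.sqrt_pos.2 hpos)]
  have : Real.exp (t + 2 * t ^ 2) = √(Real.exp (2 * t + (2 * t) ^ 2)) := by
    rw [eq_comm, Real.sqrt_eq_iff_mul_self_eq (by positivity) (by positivity), ← Real.exp_add]
    congr 1
    ring
  rw [this, ← Real.sqrt_mul (by positivity), Real.one_le_sqrt]
  linarith

/-- Two-sided concentration of a chi-squared variable around its number of degrees of freedom. -/
lemma measureReal_chiSq_deviation_le {Z : κ → Ω → ℝ}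
    (hZ : ∀ k, HasLaw (Z k) (gaussianReal 0 1) P) (hi : iIndepFun Z P) {ε : ℝ}
    (hε : 0 ≤ ε) (hε1 : ε ≤ 1) :
    P.real {ω | Fintype.card κ * ε ≤ |∑ k, Z k ω ^ 2 - Fintype.card κ|} ≤
      2 * Real.exp (-(3 / 32 * Fintype.card κ * ε ^ 2)) := by
  set n : ℝ := (Fintype.card κ : ℝ) with hn
  have main : ∀ t : ℝ, |t| ≤ 1 / 8 → Integrable (fun ω => Real.exp (t * ∑ k, Z k ω ^ 2)) P ∧
      mgf (fun ω => ∑ k, Z k ω ^ 2) P t ≤ Real.exp (n * (t + 2 * t ^ 2)) := by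
    intro t ht
    have ht' : 2 * t * (1 : NNReal) < 1 := by
      rw [NNReal.coe_one]; linarith [(abs_le.1 ht).2]
    obtain ⟨h1, h2⟩ := mgf_sum_sq_of_hasLaw hZ hi (integrable_exp_mul_sq_gaussianReal ht')
    refine ⟨h1, ?_⟩
    rw [h2, integral_exp_mul_sq_gaussianReal ht', hn, Real.exp_nat_mul]
    gcongr
    exact inv_sqrt_one_sub_le_exp ht
  have hsub : {ω | n * ε ≤ |∑ k, Z k ω ^ 2 - n|} ⊆
      {ω | n * (1 + ε) ≤ ∑ k, Z k ω ^ 2} ∪ {ω | ∑ k, Z k ω ^ 2 ≤ n * (1 - ε)} := by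
    intro ω hω
    rcases le_abs'.1 (show n * ε ≤ |∑ k, Z k ω ^ 2 - n| from hω) with h | h
    · right
      change ∑ k, Z k ω ^ 2 ≤ n * (1 - ε)
      linarith
    · left
      change n * (1 + ε) ≤ ∑ k, Z k ω ^ 2
      linarith
  have ha : |ε / 8| ≤ 1 / 8 := by rw [abs_of_nonneg (by linarith)]; linarith
  obtain ⟨i1, m1⟩ := main (ε / 8) ha
  obtain ⟨i2, m2⟩ := main (-(ε / 8)) (by rwa [abs_neg])
  have u1 := measure_ge_le_exp_mul_mgf (μ := P) (n * (1 + ε)) (show 0 ≤ ε / 8 by linarith) i1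
  have u2 := measure_le_le_exp_mul_mgf (μ := P) (n * (1 - ε)) (show -(ε / 8) ≤ 0 by linarith) i2
  have v1 : Real.exp (-(ε / 8) * (n * (1 + ε))) * mgf (fun ω => ∑ k, Z k ω ^ 2) P (ε / 8) ≤
      Real.exp (-(3 / 32 * n * ε ^ 2)) := by
    refine (mul_le_mul_of_nonneg_left m1 (by positivity)).trans_eq ?_
    rw [← Real.exp_add]
    congr 1
    ring
  have v2 : Real.exp (-(-(ε / 8)) * (n * (1 - ε))) *
      mgf (fun ω => ∑ k, Z k ω ^ 2) P (-(ε / 8)) ≤ Real.exp (-(3 / 32 * n * ε ^ 2)) := by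
    refine (mul_le_mul_of_nonneg_left m2 (by positivity)).trans_eq ?_
    rw [← Real.exp_add]
    congr 1
    ring
  calc P.real {ω | n * ε ≤ |∑ k, Z k ω ^ 2 - n|}
      ≤ P.real ({ω | n * (1 + ε) ≤ ∑ k, Z k ω ^ 2} ∪ {ω | ∑ k, Z k ω ^ 2 ≤ n * (1 - ε)}) :=
        measureReal_mono hsub
    _ ≤ _ := measureReal_union_le _ _
    _ ≤ 2 * Real.exp (-(3 / 32 * n * ε ^ 2)) := by linarith

end Chernoff

/-! ### Linear combinations of independent Gaussian variables -/

section Combination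

variable {Ω ι κ : Type*} [MeasurableSpace Ω] [Fintype ι] [Fintype κ] {P : Measure Ω}
  [IsProbabilityMeasure P]

lemma hasLaw_sum_mul_gaussian {X : ι → Ω → ℝ} (hX : ∀ i, HasLaw (X i) (gaussianReal 0 1) P)
    (hi : iIndepFun X P) (u : ι → ℝ) :
    HasLaw (fun ω => ∑ i, u i * X i ω) (gaussianReal 0 (Real.toNNReal (∑ i, u i ^ 2))) P := by
  have hY : ∀ i, HasLaw (fun ω => u i * X i ω) (gaussianReal 0 (Real.toNNReal (u i ^ 2))) P := by
    intro i
    convert gaussianReal_const_mul (hX i) (u i) using 2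
    · simp
    · ext
      simp [sq_nonneg]
  have hYi : iIndepFun (fun i ω => u i * X i ω) P :=
    hi.comp (fun i x => u i * x) (fun i => by fun_prop)
  have hg := hYi.hasGaussianLaw_fun_sum (fun i => (hY i).hasGaussianLaw)
  have hL : ∀ i, MemLp (fun ω => u i * X i ω) 2 P :=
    fun i => (hY i).hasGaussianLaw.memLp (by simp)
  refine ⟨hg.aemeasurable, ?_⟩
  rw [hg.map_eq_gaussianReal]
  have hmean : ∀ i, ∫ ω, u i * X i ω ∂P = 0 := fun i => by
    rw [(hY i).integral_eq]
    exact integral_id_gaussianReal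
  have hvar : ∀ i, Var[fun ω => u i * X i ω; P] = u i ^ 2 := fun i => by
    rw [(hY i).variance_eq, variance_id_gaussianReal, Real.coe_toNNReal _ (sq_nonneg _)]
  congr 2
  · rw [integral_finsetSum _ fun i _ => (hL i).integrable (by simp)]
    simp [hmean]
  · have := IndepFun.variance_sum (s := Finset.univ) (μ := P) (fun i _ => hL i)
      (fun i _ j _ hij => hYi.indepFun hij)
    rw [show (fun ω => ∑ i, u i * X i ω) = ∑ i, fun ω => u i * X i ω by ext; simp, this]
    simp [hvar]

/-- For an array of independent standard Gaussian variables, the same linear combination taken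
along each column gives independent Gaussian variables. -/
lemma iIndepFun_sum_mul_gaussian {G : κ → ι → Ω → ℝ}
    (hG : ∀ k i, HasLaw (G k i) (gaussianReal 0 1) P)
    (hi : iIndepFun (fun q : κ × ι => G q.1 q.2) P) (u : ι → ℝ) :
    (∀ k, HasLaw (fun ω => ∑ i, u i * G k i ω)
      (gaussianReal 0 (Real.toNNReal (∑ i, u i ^ 2))) P) ∧
    iIndepFun (fun k ω => ∑ i, u i * G k i ω) P := by
  constructor
  · intro k
    exact hasLaw_sum_mul_gaussian (hG k)
      (hi.precomp (g := fun i => (k, i)) (fun a b h => (Prod.mk.inj h).2)) u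
  have hgl : HasGaussianLaw (fun ω (q : κ × ι) => G q.1 q.2 ω) P :=
    hi.hasGaussianLaw (fun q => (hG q.1 q.2).hasGaussianLaw)
  let L : (κ × ι → ℝ) →L[ℝ] (κ → ι → ℝ) :=
    ContinuousLinearMap.pi fun k => ContinuousLinearMap.pi fun i =>
      ContinuousLinearMap.proj (R := ℝ) (φ := fun _ : κ × ι => ℝ) (k, i)
  have hgl2 : HasGaussianLaw (fun ω k i => G k i ω) P := hgl.map L
  have hgroup := hgl2.iIndepFun_of_covariance_eval fun k l hkl i j =>
    (hi.indepFun (i := (k, i)) (j := (l, j)) (by simp [hkl])).covariance_eq_zero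
      ((hG k i).hasGaussianLaw.memLp (by simp)) ((hG l j).hasGaussianLaw.memLp (by simp))
  exact hgroup.comp (fun _ x => ∑ i, u i * x i) (fun _ => by fun_prop)

/-- Small-ball bound for `∑ₖ (∑ᵢ uᵢ Gₖᵢ)²` with random coefficients `u` independent of the
Gaussian array `G`. Given `u`, the inner sums are independent `N(0, ‖u‖²)` variables. -/
lemma measureReal_sum_sq_sum_mul_gaussian_le [Nonempty κ] {G : κ → ι → Ω → ℝ} {u : ι → Ω → ℝ}
    (hG : ∀ k i, HasLaw (G k i) (gaussianReal 0 1) P)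
    (hi : iIndepFun (fun q : κ × ι => G q.1 q.2) P)
    (hu : ∀ i, AEMeasurable (u i) P)
    (huG : IndepFun (fun ω i => u i ω) (fun ω (q : κ × ι) => G q.1 q.2 ω) P) {a : ℝ} (ha : 0 ≤ a) :
    P.real {ω | ∑ k, (∑ i, u i ω * G k i ω) ^ 2 ≤ (1 / 2000) * Fintype.card κ * a} ≤
      P.real {ω | ∑ i, u i ω ^ 2 ≤ a} + 1 / 20 := by
  set μG : Measure (κ × ι → ℝ) := Measure.pi fun _ => gaussianReal 0 1
  have hGlaw : HasLaw (fun ω (q : κ × ι) => G q.1 q.2 ω) μG P :=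
    hi.hasLaw_pi (fun q => hG q.1 q.2)
  have hum : AEMeasurable (fun ω i => u i ω) P := aemeasurable_pi_lambda _ hu
  have : IsProbabilityMeasure (P.map fun ω i => u i ω) := Measure.isProbabilityMeasure_map hum
  have hjoint := huG.hasLaw_prod ⟨hum, rfl⟩ hGlaw
  set B : Set ((ι → ℝ) × (κ × ι → ℝ)) := {x | a < ∑ i, x.1 i ^ 2 ∧
    ∑ k, (∑ i, x.1 i * x.2 (k, i)) ^ 2 ≤ (1 / 2000) * Fintype.card κ * ∑ i, x.1 i ^ 2}
  have hB : MeasurableSet B := by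
    have h1 : Measurable fun x : (ι → ℝ) × (κ × ι → ℝ) => ∑ i, x.1 i ^ 2 := by fun_prop
    have h2 : Measurable fun x : (ι → ℝ) × (κ × ι → ℝ) =>
        ∑ k, (∑ i, x.1 i * x.2 (k, i)) ^ 2 := by fun_prop
    exact (measurableSet_lt measurable_const h1).inter (measurableSet_le h2 (h1.const_mul _))
  have hslice : ∀ v : ι → ℝ, μG (Prod.mk v ⁻¹' B) ≤ ENNReal.ofReal (1 / 20) := by
    intro v
    by_cases hv : a < ∑ i, v i ^ 2
    · have hpos : 0 < ∑ i, v i ^ 2 := lt_of_le_of_lt ha hv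
      have hev : iIndepFun (fun (q : κ × ι) (x : κ × ι → ℝ) => x q) μG :=
        iIndepFun_pi (X := fun _ x => x) (fun _ => aemeasurable_id)
      obtain ⟨l1, l2⟩ := iIndepFun_sum_mul_gaussian (P := μG)
        (G := fun k i (x : κ × ι → ℝ) => x (k, i))
        (fun k i => (measurePreserving_eval (fun _ => gaussianReal 0 1) (k, i)).hasLaw) hev v
      have := measureReal_sum_sq_gaussian_le (by simpa using hpos) l1 l2
      rw [Real.coe_toNNReal _ hpos.le] at this
      rw [← ENNReal.ofReal_toReal (measure_ne_top μG _)]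
      apply ENNReal.ofReal_le_ofReal
      refine le_trans ?_ this
      exact measureReal_mono fun x hx => hx.2
    · have : Prod.mk v ⁻¹' B = ∅ := by
        ext x
        simp [B, hv]
      rw [this]
      simp
  have hBle : P.real {ω | ((fun i => u i ω), fun q : κ × ι => G q.1 q.2 ω) ∈ B} ≤ 1 / 20 := by
    rw [hjoint.measureReal_eq (p := fun x => x ∈ B) hB, Measure.real]
    refine ENNReal.toReal_le_of_le_ofReal (by norm_num) ?_
    change ((P.map fun ω i => u i ω).prod μG) B ≤ _
    rw [Measure.prod_apply hB]
    calc ∫⁻ v, μG (Prod.mk v ⁻¹' B) ∂(P.map fun ω i => u i ω)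
        ≤ ∫⁻ _, ENNReal.ofReal (1 / 20) ∂(P.map fun ω i => u i ω) := lintegral_mono hslice
      _ = ENNReal.ofReal (1 / 20) := by simp
  have hsub : {ω | ∑ k, (∑ i, u i ω * G k i ω) ^ 2 ≤ (1 / 2000) * Fintype.card κ * a} ⊆
      {ω | ∑ i, u i ω ^ 2 ≤ a} ∪
        {ω | ((fun i => u i ω), fun q : κ × ι => G q.1 q.2 ω) ∈ B} := by
    intro ω hω
    by_cases h : ∑ i, u i ω ^ 2 ≤ a
    · exact Or.inl h
    · rw [not_le] at h
      exact Or.inr ⟨h, le_trans hω (by gcongr)⟩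
  exact (measureReal_mono hsub).trans ((measureReal_union_le _ _).trans (by gcongr))

end Combination

/-! ### Nets of the unit sphere and quadratic forms -/

section Net

variable {E : Type*} [NormedAddCommGroup E] [InnerProductSpace ℝ E] [FiniteDimensional ℝ E]

/-- The unit sphere of a `D`-dimensional space has a `1/2`-net of at most `5 ^ D` points. -/
lemma exists_finset_net_unitSphere :
    ∃ N : Finset E, N.card ≤ 5 ^ Module.finrank ℝ E ∧ (∀ y ∈ N, ‖y‖ = 1) ∧
      ∀ x : E, ‖x‖ = 1 → ∃ y ∈ N, ‖x - y‖ ≤ 1 / 2 := by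
  classical
  let S : Set ℕ := {n | ∃ N : Finset E, N.card = n ∧ (∀ y ∈ N, ‖y‖ = 1) ∧
    ∀ y ∈ N, ∀ z ∈ N, y ≠ z → 1 / 2 ≤ ‖y - z‖}
  have hbound : ∀ n ∈ S, n ≤ 5 ^ Module.finrank ℝ E := by
    rintro n ⟨N, rfl, h1, h2⟩
    -- dilating by `2` gives a `1`-separated subset of the ball of radius `2`
    have hinj : Function.Injective fun y : E => (2 : ℝ) • y :=
      fun a b h => smul_right_injective E (two_ne_zero' ℝ) h
    rw [← Finset.card_image_of_injective N hinj]
    apply Besicovitch.card_le_of_separated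
    · intro c hc
      obtain ⟨y, hy, rfl⟩ := Finset.mem_image.1 hc
      rw [norm_smul, h1 y hy]
      norm_num
    · intro c hc c' hc' hne
      obtain ⟨y, hy, rfl⟩ := Finset.mem_image.1 hc
      obtain ⟨z, hz, rfl⟩ := Finset.mem_image.1 hc'
      have := h2 y hy z hz fun h => hne (by rw [h])
      rw [← smul_sub, norm_smul]
      norm_num
      linarith
  have hne : S.Nonempty := ⟨0, ∅, by simp⟩
  have hbdd : BddAbove S := ⟨_, hbound⟩
  obtain ⟨N, hcard, h1, h2⟩ := Nat.sSup_mem hne hbdd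
  refine ⟨N, hcard ▸ hbound _ (Nat.sSup_mem hne hbdd), h1, fun x hx => ?_⟩
  by_contra! hcon
  have hxN : x ∉ N := fun h => by
    have := hcon x h
    rw [sub_self, norm_zero] at this
    linarith
  have hmem : N.card + 1 ∈ S := by
    refine ⟨insert x N, Finset.card_insert_of_notMem hxN, ?_, ?_⟩
    · intro y hy
      rcases Finset.mem_insert.1 hy with rfl | hy
      exacts [hx, h1 y hy]
    · intro y hy z hz hyz
      rcases Finset.mem_insert.1 hy with rfl | hy' <;>
        rcases Finset.mem_insert.1 hz with rfl | hz'
      · exact absurd rfl hyz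
      · exact (hcon z hz').le
      · rw [norm_sub_rev]
        exact (hcon y hy').le
      · exact h2 y hy' z hz' hyz
  have := le_csSup hbdd hmem
  omega

variable {F : Type*} [NormedAddCommGroup F] [InnerProductSpace ℝ F]

lemma norm_sq_lin_comb {G : Type*} [NormedAddCommGroup G] [InnerProductSpace ℝ G] (a b : ℝ)
    (x y : G) :
    ‖a • x - b • y‖ ^ 2 = a ^ 2 * ‖x‖ ^ 2 - 2 * (a * b) * inner ℝ x y + b ^ 2 * ‖y‖ ^ 2 := by
  rw [norm_sub_sq_real, norm_smul, norm_smul, inner_smul_left, inner_smul_right, mul_pow, mul_pow,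
    Real.norm_eq_abs, Real.norm_eq_abs, sq_abs, sq_abs]
  simp
  ring

/-- The quadratic form `q x = c ‖T x‖² - ‖x‖²` is controlled by its values on a `1/2`-net of the
unit sphere.  For a maximiser `x` of `|q|` on the sphere and a net point `y` near it, the vectors
`w = (5/2) x - (3/2) y` and `w' = (3/2) x - (5/2) y` satisfy `q x - q y = (q w - q w') / 4` and
`(‖w‖² + ‖w'‖²) / 4 ≤ 31/32`, so that the maximum is at most `32` times the maximum on the net. -/
lemma abs_quadratic_le_of_net (T : E →ₗ[ℝ] F) (c ε : ℝ) {N : Finset E}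
    (hN : ∀ y ∈ N, ‖y‖ = 1) (hnet : ∀ x : E, ‖x‖ = 1 → ∃ y ∈ N, ‖x - y‖ ≤ 1 / 2)
    (hε : ∀ y ∈ N, |c * ‖T y‖ ^ 2 - ‖y‖ ^ 2| ≤ ε / 32) (x : E) :
    |c * ‖T x‖ ^ 2 - ‖x‖ ^ 2| ≤ ε * ‖x‖ ^ 2 := by
  set q : E → ℝ := fun x => c * ‖T x‖ ^ 2 - ‖x‖ ^ 2 with hq
  have hqs : ∀ (r : ℝ) (x : E), q (r • x) = r ^ 2 * q x := by
    intro r x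
    simp only [hq, map_smul, norm_smul, mul_pow, Real.norm_eq_abs, sq_abs]
    ring
  rcases eq_or_ne x 0 with rfl | hx0
  · simp
  have hcont : Continuous fun x => |q x| := by
    have : Continuous T := T.continuous_of_finiteDimensional
    fun_prop
  have hxn : ‖(‖x‖⁻¹ : ℝ) • x‖ = 1 := norm_smul_inv_norm (𝕜 := ℝ) hx0
  have hcomp : IsCompact (Metric.sphere (0 : E) 1) := isCompact_sphere 0 1
  obtain ⟨x₀, hx₀, hmax⟩ := hcomp.exists_isMaxOn ⟨_, mem_sphere_zero_iff_norm.2 hxn⟩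
    hcont.continuousOn
  set K := |q x₀| with hK
  have hqK : ∀ z : E, |q z| ≤ K * ‖z‖ ^ 2 := by
    intro z
    rcases eq_or_ne z 0 with rfl | hz
    · simp [hq]
    have h1 : |q ((‖z‖⁻¹ : ℝ) • z)| ≤ K :=
      hmax (mem_sphere_zero_iff_norm.2 (norm_smul_inv_norm (𝕜 := ℝ) hz))
    have h2 : q z = ‖z‖ ^ 2 * q ((‖z‖⁻¹ : ℝ) • z) := by
      rw [hqs]
      have : ‖z‖ ≠ 0 := norm_ne_zero_iff.2 hz
      field_simp
    rw [h2, abs_mul, abs_of_nonneg (sq_nonneg ‖z‖), mul_comm]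
    gcongr
  have hx₀1 : ‖x₀‖ = 1 := mem_sphere_zero_iff_norm.1 hx₀
  obtain ⟨y, hy, hxy⟩ := hnet x₀ hx₀1
  have hy1 := hN y hy
  have hid : q x₀ = q y + (q ((5 / 2 : ℝ) • x₀ - (3 / 2 : ℝ) • y) -
      q ((3 / 2 : ℝ) • x₀ - (5 / 2 : ℝ) • y)) / 4 := by
    simp only [hq, map_sub, map_smul, norm_sq_lin_comb]
    ring
  have hin : 7 / 8 ≤ inner ℝ x₀ y := by
    have h1 := norm_sub_sq_real x₀ y
    rw [hx₀1, hy1] at h1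
    have h2 : ‖x₀ - y‖ ^ 2 ≤ (1 / 2) ^ 2 := by gcongr
    linarith
  have hw := hqK ((5 / 2 : ℝ) • x₀ - (3 / 2 : ℝ) • y)
  have hw' := hqK ((3 / 2 : ℝ) • x₀ - (5 / 2 : ℝ) • y)
  rw [norm_sq_lin_comb, hx₀1, hy1] at hw hw'
  have hKn : 0 ≤ K := abs_nonneg _
  have hKi := mul_le_mul_of_nonneg_left hin hKn
  have hKε : K ≤ ε := by
    have hqy : |q y| ≤ ε / 32 := hε y hy
    have hKle : K ≤ |q y| + (|q ((5 / 2 : ℝ) • x₀ - (3 / 2 : ℝ) • y)| +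
        |q ((3 / 2 : ℝ) • x₀ - (5 / 2 : ℝ) • y)|) / 4 := by
      rw [hK, hid]
      refine (abs_add_le _ _).trans ?_
      rw [abs_div, abs_of_pos (show (0 : ℝ) < 4 by norm_num)]
      gcongr
      exact abs_sub _ _
    nlinarith
  exact (hqK x).trans (by gcongr)

end Net

/-! ### The trace inner product in coordinates -/

section Coordinates

variable {d m : ℕ}

lemma norm_sq_eq_sum (M : Matrix (Fin d) (Fin d) ℝ) :
    ‖M‖ ^ 2 = ∑ q : Fin d × Fin d, M q.1 q.2 ^ 2 := by
  rw [Matrix.frobenius_norm_def, ← Real.sqrt_eq_rpow, Real.sq_sqrt (by positivity),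
    Fintype.sum_prod_type]
  simp

lemma matInner_eq_sum (X Y : Matrix (Fin d) (Fin d) ℝ) :
    matInner X Y = ∑ q : Fin d × Fin d, Y q.1 q.2 * X q.1 q.2 := by
  rw [matInner, Fintype.sum_prod_type, Finset.sum_comm]
  simp [Matrix.trace, Matrix.mul_apply, mul_comm]

lemma norm_measurementOp_sq (A : Fin m → Matrix (Fin d) (Fin d) ℝ)
    (M : Matrix (Fin d) (Fin d) ℝ) :
    ‖measurementOp A M‖ ^ 2 = ∑ i, matInner (A i) M ^ 2 := by
  rw [EuclideanSpace.norm_sq_eq]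
  simp [measurementOp]

/-- The measurement operator, acting on the Euclidean space of the entries. -/
noncomputable def entryMeasurement (A : Fin m → Matrix (Fin d) (Fin d) ℝ) :
    EuclideanSpace ℝ (Fin d × Fin d) →ₗ[ℝ] EuclideanSpace ℝ (Fin m) where
  toFun x := WithLp.toLp 2 fun i => ∑ q, x q * A i q.1 q.2
  map_add' x y := by
    ext i
    simp [add_mul, Finset.sum_add_distrib]
  map_smul' r x := by
    ext i
    simp [Finset.mul_sum, mul_assoc]

lemma norm_entryMeasurement_sq (A : Fin m → Matrix (Fin d) (Fin d) ℝ)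
    (x : EuclideanSpace ℝ (Fin d × Fin d)) :
    ‖entryMeasurement A x‖ ^ 2 = ∑ i, (∑ q, x q * A i q.1 q.2) ^ 2 := by
  rw [EuclideanSpace.norm_sq_eq]
  simp [entryMeasurement]

/-- It is enough to test the restricted isometry property on a net of the unit sphere of the
entries. -/
lemma L2RIP_of_net (A : Fin m → Matrix (Fin d) (Fin d) ℝ) (r : ℕ) {δ : ℝ}
    {N : Finset (EuclideanSpace ℝ (Fin d × Fin d))} (hN : ∀ y ∈ N, ‖y‖ = 1)
    (hnet : ∀ x : EuclideanSpace ℝ (Fin d × Fin d), ‖x‖ = 1 → ∃ y ∈ N, ‖x - y‖ ≤ 1 / 2)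
    (hδ : ∀ y ∈ N, |1 / (m : ℝ) * ∑ i, (∑ q, y q * A i q.1 q.2) ^ 2 - 1| ≤ δ / 32) :
    L2RIP A r δ := by
  intro M _
  have h := abs_quadratic_le_of_net (entryMeasurement A) (1 / (m : ℝ)) δ hN hnet
    (fun y hy => by
      rw [norm_entryMeasurement_sq, hN y hy, one_pow]
      exact hδ y hy) (WithLp.toLp 2 fun q => M q.1 q.2)
  rw [norm_entryMeasurement_sq, EuclideanSpace.norm_sq_eq] at h
  simp only [Real.norm_eq_abs, sq_abs] at h
  rw [← norm_sq_eq_sum] at h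
  rw [norm_measurementOp_sq]
  simp only [matInner_eq_sum]
  obtain ⟨h1, h2⟩ := abs_le.1 h
  constructor <;> linarith

end Coordinates

/-! ### The restricted isometry property -/

section RIP

variable {Ω : Type*} [MeasurableSpace Ω] {P : Measure Ω} [IsProbabilityMeasure P] {d m : ℕ}

lemma one_sub_le_measureReal_L2RIP (hm : 0 < m) {A : Fin m → Ω → Matrix (Fin d) (Fin d) ℝ}
    (hA : ∀ i j k, HasLaw (fun ω => A i ω j k) (gaussianReal 0 1) P)
    (hi : iIndepFun (fun (q : Fin m × Fin d × Fin d) ω => A q.1 ω q.2.1 q.2.2) P)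
    {δ : ℝ} (hδ : 0 < δ) (hδ1 : δ < 1) (hmd : 50000 * ((d : ℝ) ^ 2 / δ ^ 2) ≤ m) :
    1 - 2 * Real.exp (-(3 / 65536 * (m : ℝ) * δ ^ 2)) ≤
      P.real {ω | L2RIP (fun i => A i ω) d δ} := by
  obtain ⟨N, hcard, hN, hnet⟩ :=
    exists_finset_net_unitSphere (E := EuclideanSpace ℝ (Fin d × Fin d))
  have hm' : (0 : ℝ) < m := by exact_mod_cast hm
  let S : EuclideanSpace ℝ (Fin d × Fin d) → Ω → ℝ :=
    fun y ω => ∑ i, (∑ q, y q * A i ω q.1 q.2) ^ 2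
  have htail : ∀ y ∈ N, P.real {ω | (m : ℝ) * (δ / 32) ≤ |S y ω - m|} ≤
      2 * Real.exp (-(3 / 32768 * (m : ℝ) * δ ^ 2)) := by
    intro y hy
    obtain ⟨l1, l2⟩ := iIndepFun_sum_mul_gaussian (G := fun i q ω => A i ω q.1 q.2)
      (fun i q => hA i q.1 q.2) hi (fun q => y q)
    have hone : Real.toNNReal (∑ q, y q ^ 2) = 1 := by
      have := EuclideanSpace.norm_sq_eq y
      rw [hN y hy] at this
      simp only [Real.norm_eq_abs, sq_abs] at this
      rw [← this]
      simp
    rw [hone] at l1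
    have := measureReal_chiSq_deviation_le l1 l2 (ε := δ / 32) (by linarith) (by linarith)
    rw [Fintype.card_fin] at this
    refine this.trans_eq ?_
    congr 3
    ring
  have hsub : {ω | L2RIP (fun i => A i ω) d δ}ᶜ ⊆
      ⋃ y ∈ N, {ω | (m : ℝ) * (δ / 32) ≤ |S y ω - m|} := by
    intro ω hω
    by_contra hcon
    simp only [Set.mem_iUnion, Set.mem_ofPred_eq, not_exists, not_le] at hcon
    refine hω (L2RIP_of_net _ d hN hnet fun y hy => ?_)
    have h1 : 1 / (m : ℝ) * ∑ i, (∑ q, y q * A i ω q.1 q.2) ^ 2 - 1 =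
        (S y ω - m) / m := by
      simp only [S]
      field_simp
    rw [h1, abs_div, abs_of_pos hm', div_le_iff₀ hm', mul_comm]
    exact (hcon y hy).le
  -- the net costs half of the exponent, and `C₀ = 50000` is large enough for that
  have hexp : (N.card : ℝ) ≤ Real.exp (3 / 65536 * (m : ℝ) * δ ^ 2) := by
    have h5 : (5 : ℝ) ≤ Real.exp 2 := by
      have := Real.quadratic_le_exp_of_nonneg (show (0 : ℝ) ≤ 2 by norm_num)
      linarith
    have hc : (N.card : ℝ) ≤ (5 : ℝ) ^ (d * d) := by
      have : N.card ≤ 5 ^ (d * d) := by simpa using hcard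
      exact_mod_cast this
    have hmd' : 50000 * (d : ℝ) ^ 2 ≤ m * δ ^ 2 := by
      rwa [← mul_div_assoc, div_le_iff₀ (by positivity)] at hmd
    calc (N.card : ℝ) ≤ (5 : ℝ) ^ (d * d) := hc
      _ ≤ Real.exp 2 ^ (d * d) := by gcongr
      _ = Real.exp (2 * (d : ℝ) ^ 2) := by
          rw [← Real.exp_nat_mul]
          congr 1
          push_cast
          ring
      _ ≤ _ := by
          apply Real.exp_le_exp.2
          nlinarith [sq_nonneg (d : ℝ)]
  have hbad : P.real {ω | L2RIP (fun i => A i ω) d δ}ᶜ ≤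
      2 * Real.exp (-(3 / 65536 * (m : ℝ) * δ ^ 2)) :=
    calc P.real {ω | L2RIP (fun i => A i ω) d δ}ᶜ
        ≤ P.real (⋃ y ∈ N, {ω | (m : ℝ) * (δ / 32) ≤ |S y ω - m|}) :=
          measureReal_mono hsub (measure_ne_top _ _)
      _ ≤ ∑ y ∈ N, P.real {ω | (m : ℝ) * (δ / 32) ≤ |S y ω - m|} :=
          measureReal_biUnion_finset_le _ _
      _ ≤ ∑ y ∈ N, 2 * Real.exp (-(3 / 32768 * (m : ℝ) * δ ^ 2)) := Finset.sum_le_sum htail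
      _ = N.card * (2 * Real.exp (-(3 / 32768 * (m : ℝ) * δ ^ 2))) := by
          rw [Finset.sum_const, nsmul_eq_mul]
      _ ≤ Real.exp (3 / 65536 * (m : ℝ) * δ ^ 2) *
          (2 * Real.exp (-(3 / 32768 * (m : ℝ) * δ ^ 2))) := by gcongr
      _ = 2 * Real.exp (-(3 / 65536 * (m : ℝ) * δ ^ 2)) := by
          rw [mul_left_comm, ← Real.exp_add]
          congr 2
          ring
  -- subadditivity suffices here, without measurability of the event
  have htot : (1 : ℝ) ≤ P.real {ω | L2RIP (fun i => A i ω) d δ} +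
      P.real {ω | L2RIP (fun i => A i ω) d δ}ᶜ := by
    rw [← probReal_univ (μ := P), ← Set.union_compl_self {ω | L2RIP (fun i => A i ω) d δ}]
    exact measureReal_union_le _ _
  linarith

end RIP

/-! ### Anticoncentration of chi-squared variables -/

section Anticoncentration

open Filter Topology

lemma eventually_measure_Icc_lt {ν : Measure ℝ} [IsFiniteMeasure ν] (h0 : ν {0} = 0) {η : ENNReal}
    (hη : 0 < η) : ∀ᶠ c in 𝓝[>] (0 : ℝ), ν (Set.Icc (-c) c) < η := by
  have h := tendsto_measure_cthickening (μ := ν) (s := {(0 : ℝ)}) ⟨1, one_pos, measure_ne_top _ _⟩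
  rw [closure_singleton, h0] at h
  filter_upwards [(h.mono_left nhdsWithin_le_nhds).eventually_lt_const hη, self_mem_nhdsWithin]
    with c hc hc0
  rwa [Metric.cthickening_singleton _ (le_of_lt hc0), Real.closedBall_eq_Icc, zero_sub,
    zero_add] at hc

lemma measure_add_eq_const_eq_zero {Ω : Type*} [MeasurableSpace Ω] {P : Measure Ω}
    [IsProbabilityMeasure P] {R Y : Ω → ℝ} (hR : AEMeasurable R P) (hY : AEMeasurable Y P)
    (h : IndepFun R Y P) (hatom : ∀ y, P.map Y {y} = 0) (c : ℝ) :
    P {ω | R ω + Y ω = c} = 0 := by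
  have : IsProbabilityMeasure (P.map R) := Measure.isProbabilityMeasure_map hR
  have : IsProbabilityMeasure (P.map Y) := Measure.isProbabilityMeasure_map hY
  have hl := h.hasLaw_prod ⟨hR, rfl⟩ ⟨hY, rfl⟩
  have hm : MeasurableSet {x : ℝ × ℝ | x.1 + x.2 = c} :=
    measurableSet_eq_fun (by fun_prop) (by fun_prop)
  have h1 := hl.measure_eq (p := fun x => x.1 + x.2 = c) hm
  refine h1.trans ?_
  rw [Measure.prod_apply hm]
  have : ∀ r : ℝ, Prod.mk r ⁻¹' {x : ℝ × ℝ | x.1 + x.2 = c} = {c - r} := by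
    intro r
    ext y
    simp only [Set.mem_preimage, Set.mem_ofPred_eq, Set.mem_singleton_iff]
    constructor <;> intro h <;> linarith
  simp [this, hatom]

lemma measure_sq_eq_gaussianReal (y : ℝ) : gaussianReal 0 1 {x | x ^ 2 = y} = 0 := by
  have := nullSingletonClass_gaussianReal (μ := 0) (v := 1) one_ne_zero
  refine measure_mono_null (t := {√y, -√y}) ?_ ((Set.toFinite _).measure_zero _)
  intro x hx
  have hx' : x ^ 2 = y := hx
  rw [← hx', Real.sqrt_sq_eq_abs]
  rcases abs_choice x with h | h <;> simp [h]

/-- A chi-squared variable with `m` degrees of freedom deviates from `m` by at least a constant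
times `√m`, with probability at least `1/2`, uniformly in `m`. For large `m` this is the central
limit theorem, and for each of the remaining `m` the distribution has no atom. -/
theorem exists_chiSq_anticoncentration :
    ∃ c : ℝ, 0 < c ∧ ∀ m : ℕ, 0 < m →
      (Measure.pi fun _ : Fin m => gaussianReal 0 1) {x | |∑ i, x i ^ 2 - m| ≤ c * √m} ≤ 1 / 2 := by
  set PN : Measure (ℕ → ℝ) := Measure.infinitePi fun _ => gaussianReal 0 1 with hPN
  let X : ℕ → (ℕ → ℝ) → ℝ := fun k x => x k ^ 2
  have hev : ∀ k, HasLaw (fun x : ℕ → ℝ => x k) (gaussianReal 0 1) PN := fun k =>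
    (measurePreserving_eval_infinitePi (fun _ : ℕ => gaussianReal 0 1) k).hasLaw
  have hind0 : iIndepFun (fun (k : ℕ) (x : ℕ → ℝ) => x k) PN :=
    iIndepFun_infinitePi (X := fun _ x => x) fun _ => measurable_id
  have hind : iIndepFun X PN := hind0.comp (fun _ x => x ^ 2) (fun _ => by fun_prop)
  have hXm : ∀ k, Measurable (X k) := fun k => by fun_prop
  have hident : ∀ k, IdentDistrib (X k) (X 0) PN PN := fun k =>
    (IdentDistrib.mk (hev k).aemeasurable (hev 0).aemeasurable
      ((hev k).map_eq.trans (hev 0).map_eq.symm)).comp (u := fun x : ℝ => x ^ 2) (by fun_prop)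
  have hL2 : MemLp (X 0) 2 PN := by
    have h4 : MemLp (fun x : ℕ → ℝ => x 0) 4 PN := (hev 0).hasGaussianLaw.memLp (by simp)
    have := h4.norm_rpow_div 2
    have h42 : (4 : ENNReal) / 2 = 2 := by
      rw [show (4 : ENNReal) = 2 * 2 by norm_num,
        ENNReal.mul_div_cancel_right (by simp) (by simp)]
    rw [h42] at this
    simpa using this
  have hmean : PN[X 0] = 1 := by
    have h1 : ∫ x : ℝ, x ^ 2 ∂(gaussianReal 0 1) = 1 := by
      have := variance_id_gaussianReal (μ := 0) (v := 1)
      rw [variance_of_integral_eq_zero (by fun_prop) (by simp)] at this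
      simpa using this
    rw [← h1]
    exact (hev 0).integral_comp (f := fun x : ℝ => x ^ 2) (by fun_prop)
  have hatomX : ∀ k y, PN.map (X k) {y} = 0 := fun k y => by
    rw [Measure.map_apply (hXm k) (measurableSet_singleton y)]
    exact ((hev k).measure_eq (p := fun x => x ^ 2 = y)
      (measurableSet_eq_fun (by fun_prop) (by fun_prop))).trans (measure_sq_eq_gaussianReal y)
  have hvar : Var[X 0; PN].toNNReal ≠ 0 := by
    intro h
    have h0 : Var[X 0; PN] = 0 :=
      le_antisymm (Real.toNNReal_eq_zero.1 h) (variance_nonneg _ _)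
    have h1 := ae_eq_integral_of_variance_eq_zero hL2 h0
    have h2 : PN {x | X 0 x = PN[X 0]} = 0 := by
      have := hatomX 0 (PN[X 0])
      rwa [Measure.map_apply (hXm 0) (measurableSet_singleton _)] at this
    have h3 : PN {x | X 0 x = PN[X 0]}ᶜ = 0 := h1
    have h4 : PN Set.univ ≤ 0 := by
      rw [← Set.union_compl_self {x | X 0 x = PN[X 0]}]
      exact (measure_union_le _ _).trans (by rw [h2, h3, add_zero])
    simp at h4
  -- the normalised sums, their laws, and the weak limit of these
  let W : ℕ → (ℕ → ℝ) → ℝ := fun n x => (√n)⁻¹ * (∑ k ∈ Finset.range n, X k x - n * PN[X 0])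
  have hWm : ∀ n, Measurable (W n) := fun n => by fun_prop
  have hclt := tendstoInDistribution_inv_sqrt_mul_sum_sub (P := PN) (X := X)
    (Y := id) (P' := gaussianReal 0 Var[X 0; PN].toNNReal) HasLaw.id hL2 hind hident
  have hlim0 : gaussianReal 0 Var[X 0; PN].toNNReal {0} = 0 := by
    have := nullSingletonClass_gaussianReal (μ := 0) hvar
    exact measure_singleton 0
  have hWatom : ∀ n, 0 < n → PN.map (W n) {0} = 0 := by
    intro n hn
    rw [Measure.map_apply (hWm n) (measurableSet_singleton 0)]
    obtain ⟨k, rfl⟩ := Nat.exists_eq_succ_of_ne_zero hn.ne'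
    have h1 := measure_add_eq_const_eq_zero (P := PN) (R := ∑ j ∈ Finset.range k, X j) (Y := X k)
      (Finset.aemeasurable_sum _ fun j _ => (hXm j).aemeasurable) (hXm k).aemeasurable
      (hind.indepFun_sum_range_succ hXm k) (hatomX k) (((k + 1 : ℕ) : ℝ) * PN[X 0])
    refine measure_mono_null (fun x hx => ?_) h1
    have hx' : (√((k + 1 : ℕ) : ℝ))⁻¹ *
      (∑ j ∈ Finset.range (k + 1), X j x - ((k + 1 : ℕ) : ℝ) * PN[X 0]) = 0 := hx
    have hs : (√((k + 1 : ℕ) : ℝ))⁻¹ ≠ 0 := by positivity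
    have := (mul_eq_zero.1 hx').resolve_left hs
    rw [Finset.sum_range_succ] at this
    change (∑ j ∈ Finset.range k, X j) x + X k x = _
    rw [Finset.sum_apply]
    linarith
  have hhalf : (0 : ENNReal) < 1 / 2 := by simp
  obtain ⟨c₀, hc₀, hc₀pos⟩ :=
    ((eventually_measure_Icc_lt hlim0 hhalf).and self_mem_nhdsWithin).exists
  have hlarge : ∀ᶠ n in atTop, PN.map (W n) (Set.Icc (-c₀) c₀) < 1 / 2 := by
    have h1 := ProbabilityMeasure.limsup_measure_closed_le_of_tendsto hclt.tendsto
      (isClosed_Icc (a := -c₀) (b := c₀))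
    refine eventually_lt_of_limsup_lt (lt_of_le_of_lt h1 ?_)
    simpa using hc₀
  obtain ⟨M, hM⟩ := eventually_atTop.1 hlarge
  have hsmall : ∀ᶠ c in 𝓝[>] (0 : ℝ), ∀ n ∈ Finset.Icc 1 M,
      PN.map (W n) (Set.Icc (-c) c) < 1 / 2 := by
    rw [Filter.eventually_all_finset]
    intro n hn
    exact eventually_measure_Icc_lt (hWatom n (Finset.mem_Icc.1 hn).1) hhalf
  obtain ⟨c, ⟨hc1, hc2⟩, hc3⟩ := ((hsmall.and
    (nhdsWithin_le_nhds (Iio_mem_nhds hc₀pos) : ∀ᶠ c in 𝓝[>] (0 : ℝ), c < c₀)).and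
    self_mem_nhdsWithin).exists
  refine ⟨c, hc3, fun m hm => ?_⟩
  have hc : PN.map (W m) (Set.Icc (-c) c) ≤ 1 / 2 := by
    rcases le_total m M with h | h
    · exact (hc1 m (Finset.mem_Icc.2 ⟨hm, h⟩)).le
    · exact (measure_mono (Set.Icc_subset_Icc (neg_le_neg hc2.le) hc2.le)).trans (hM m h).le
  have hlaw : HasLaw (fun (x : ℕ → ℝ) (i : Fin m) => x i)
      (Measure.pi fun _ : Fin m => gaussianReal 0 1) PN :=
    (hind0.precomp (g := fun i : Fin m => (i : ℕ)) Fin.val_injective).hasLaw_pi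
      fun i => hev i
  refine le_trans (le_of_eq ?_) hc
  rw [Measure.map_apply (hWm m) measurableSet_Icc]
  refine (hlaw.measure_eq (p := fun x => |∑ i, x i ^ 2 - m| ≤ c * √m)
    (measurableSet_le (by fun_prop) (by fun_prop))).symm.trans ?_
  congr 1
  ext x
  have hs : 0 < √(m : ℝ) := Real.sqrt_pos.2 (by exact_mod_cast hm)
  simp only [Set.mem_ofPred_eq, Set.mem_preimage, Set.mem_Icc, W, X, hmean, mul_one]
  rw [Fin.sum_univ_eq_sum_range (fun k => x k ^ 2) m, ← abs_le, abs_mul, abs_inv,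
    abs_of_pos hs, inv_mul_le_iff₀ hs, mul_comm c]

end Anticoncentration

/-! ### The error of the noisy gradient map -/

section Gradient

variable {d m : ℕ}

lemma continuous_noisyGradientMap (A : Fin m → Matrix (Fin d) (Fin d) ℝ) (s : Fin m → ℝ) :
    Continuous fun X => noisyGradientMap A s X := by
  unfold noisyGradientMap matInner
  fun_prop

lemma norm_noisyGradientMap_sub_le_iSup (A : Fin m → Matrix (Fin d) (Fin d) ℝ) (s : Fin m → ℝ)
    {X : Matrix (Fin d) (Fin d) ℝ} (hX : ‖X‖ = 1) :
    ‖noisyGradientMap A s X - X‖ ≤ ⨆ X : unitRankSphere d d, ‖noisyGradientMap A s X.1 - X.1‖ := by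
  have hmem : X ∈ unitRankSphere d d := ⟨hX, by simpa using X.rank_le_width⟩
  have hcont : Continuous fun X : Matrix (Fin d) (Fin d) ℝ => ‖noisyGradientMap A s X - X‖ :=
    ((continuous_noisyGradientMap A s).sub continuous_id).norm
  have : ProperSpace (Matrix (Fin d) (Fin d) ℝ) := FiniteDimensional.proper_real _
  obtain ⟨b, hb⟩ := (isCompact_sphere (0 : Matrix (Fin d) (Fin d) ℝ) 1).bddAbove_image
    hcont.continuousOn
  -- an unbounded real supremum would be zero
  have hbdd : BddAbove (Set.range fun X : unitRankSphere d d =>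
      ‖noisyGradientMap A s X.1 - X.1‖) := by
    refine ⟨b, ?_⟩
    rintro _ ⟨Y, rfl⟩
    exact hb ⟨Y.1, mem_sphere_zero_iff_norm.2 Y.2.1, rfl⟩
  exact le_ciSup hbdd ⟨X, hmem⟩

lemma noisyGradientMap_eq_add (A : Fin m → Matrix (Fin d) (Fin d) ℝ) (s : Fin m → ℝ)
    (X : Matrix (Fin d) (Fin d) ℝ) :
    noisyGradientMap A s X = noisyGradientMap A 0 X + noisyGradientMap A s 0 := by
  simp [noisyGradientMap, matInner, add_smul, Finset.sum_add_distrib]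

lemma noisyGradientMap_zero_neg (A : Fin m → Matrix (Fin d) (Fin d) ℝ)
    (X : Matrix (Fin d) (Fin d) ℝ) :
    noisyGradientMap A 0 (-X) = -noisyGradientMap A 0 X := by
  simp [noisyGradientMap, matInner]

/-- The error at `±X` is `±L + N` with `L` the noiseless error at `X` and `N` the pure noise term,
so that neither of the two can cancel the other at both points. -/
lemma norm_noise_le_iSup_and_norm_noiseless_le_iSup (A : Fin m → Matrix (Fin d) (Fin d) ℝ)
    (s : Fin m → ℝ) {X : Matrix (Fin d) (Fin d) ℝ} (hX : ‖X‖ = 1) :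
    ‖noisyGradientMap A s 0‖ ≤
        (⨆ X : unitRankSphere d d, ‖noisyGradientMap A s X.1 - X.1‖) ∧
      ‖noisyGradientMap A 0 X - X‖ ≤
        ⨆ X : unitRankSphere d d, ‖noisyGradientMap A s X.1 - X.1‖ := by
  have h1 := norm_noisyGradientMap_sub_le_iSup A s hX
  have h2 := norm_noisyGradientMap_sub_le_iSup A s (X := -X) (by rwa [norm_neg])
  rw [noisyGradientMap_eq_add] at h1 h2
  rw [noisyGradientMap_zero_neg] at h2
  set S := ⨆ X : unitRankSphere d d, ‖noisyGradientMap A s X.1 - X.1‖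
  set L := noisyGradientMap A 0 X
  set N := noisyGradientMap A s 0
  constructor
  · have h3 : (2 : ℝ) • N = (L + N - X) + (-L + N - -X) := by
      rw [two_smul]; abel
    have h4 := norm_add_le (L + N - X) (-L + N - -X)
    rw [← h3, norm_smul, Real.norm_two] at h4
    linarith
  · have h3 : (2 : ℝ) • (L - X) = (L + N - X) - (-L + N - -X) := by
      rw [two_smul]; abel
    have h4 := norm_sub_le (L + N - X) (-L + N - -X)
    rw [← h3, norm_smul, Real.norm_two] at h4
    linarith

lemma norm_single_one (j k : Fin d) :
    ‖(Matrix.single j k 1 : Matrix (Fin d) (Fin d) ℝ)‖ = 1 := by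
  have h : ‖(Matrix.single j k 1 : Matrix (Fin d) (Fin d) ℝ)‖ ^ 2 = 1 := by
    rw [norm_sq_eq_sum, Finset.sum_eq_single (j, k)]
    · simp
    · rintro ⟨a, b⟩ - hne
      rw [Matrix.single_apply_of_ne]
      · simp
      · rintro ⟨rfl, rfl⟩
        exact hne rfl
    · simp
  exact (pow_eq_one_iff_of_nonneg (norm_nonneg _) two_ne_zero).1 h

lemma matInner_single (X : Matrix (Fin d) (Fin d) ℝ) (j k : Fin d) :
    matInner X (Matrix.single j k 1) = X j k := by
  rw [matInner_eq_sum, Finset.sum_eq_single (j, k)]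
  · simp
  · rintro ⟨a, b⟩ - hne
    rw [Matrix.single_apply_of_ne]
    · simp
    · rintro ⟨rfl, rfl⟩
      exact hne rfl
  · simp

lemma norm_noise_sq (A : Fin m → Matrix (Fin d) (Fin d) ℝ) (s : Fin m → ℝ) :
    ‖noisyGradientMap A s 0‖ ^ 2 =
      (1 / (m : ℝ)) ^ 2 * ∑ q : Fin d × Fin d, (∑ i, s i * A i q.1 q.2) ^ 2 := by
  rw [norm_sq_eq_sum, Finset.mul_sum]
  simp [noisyGradientMap, matInner, Matrix.sum_apply, mul_pow]

/-- Away from the position `e`, the entries of the noiseless error at the matrix unit of `e` are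
empirical correlations with the entry at `e`. -/
lemma sum_sq_le_norm_noiseless_sq (A : Fin m → Matrix (Fin d) (Fin d) ℝ) (e : Fin d × Fin d) :
    (1 / (m : ℝ)) ^ 2 *
        ∑ q : {q : Fin d × Fin d // q ≠ e}, (∑ i, A i e.1 e.2 * A i q.1.1 q.1.2) ^ 2 ≤
      ‖noisyGradientMap A 0 (Matrix.single e.1 e.2 1) - Matrix.single e.1 e.2 1‖ ^ 2 := by
  rw [norm_sq_eq_sum, Finset.mul_sum]
  have hterm : ∀ q : {q : Fin d × Fin d // q ≠ e},
      (1 / (m : ℝ)) ^ 2 * (∑ i, A i e.1 e.2 * A i q.1.1 q.1.2) ^ 2 =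
      ((noisyGradientMap A 0 (Matrix.single e.1 e.2 1) - Matrix.single e.1 e.2 1 :
        Matrix (Fin d) (Fin d) ℝ) q.1.1 q.1.2) ^ 2 := by
    rintro ⟨⟨a, b⟩, hq⟩
    have hne : ¬(e.1 = a ∧ e.2 = b) := fun h => hq (Prod.ext h.1.symm h.2.symm)
    rw [Matrix.sub_apply, Matrix.single_apply_of_ne _ _ _ _ _ hne]
    simp [noisyGradientMap, matInner_single, Matrix.sum_apply, mul_pow]
  simp_rw [hterm]
  have := Finset.sum_subtype_eq_sum_filter (s := Finset.univ) (p := fun q : Fin d × Fin d => q ≠ e)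
    (fun q : Fin d × Fin d => ((noisyGradientMap A 0 (Matrix.single e.1 e.2 1) -
      Matrix.single e.1 e.2 1 : Matrix (Fin d) (Fin d) ℝ) q.1 q.2) ^ 2)
  rw [Finset.subtype_univ] at this
  rw [this]
  exact Finset.sum_le_sum_of_subset_of_nonneg (Finset.filter_subset _ _)
    fun _ _ _ => sq_nonneg _

/-- For `1 × 1` matrices the noiseless error is the centred empirical second moment. -/
lemma norm_noiseless_one_dim (hm : 0 < m) (A : Fin m → Matrix (Fin 1) (Fin 1) ℝ) :
    ‖noisyGradientMap A 0 (Matrix.single 0 0 1) - Matrix.single 0 0 1‖ =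
      |∑ i, A i 0 0 ^ 2 - m| / m := by
  have hm' : (0 : ℝ) < m := by exact_mod_cast hm
  have h : ‖noisyGradientMap A 0 (Matrix.single 0 0 1) - Matrix.single 0 0 1‖ ^ 2 =
      (|∑ i, A i 0 0 ^ 2 - m| / m) ^ 2 := by
    rw [norm_sq_eq_sum, div_pow, sq_abs, ← div_pow, Fintype.sum_prod_type]
    simp only [noisyGradientMap, matInner_single, Finset.univ_unique, Finset.sum_singleton,
      Fin.default_eq_zero, Pi.zero_apply, add_zero, Matrix.sub_apply,
      Matrix.smul_apply, Matrix.sum_apply, smul_eq_mul]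
    congr 1
    rw [Matrix.single_apply_same]
    field_simp
  exact (pow_left_inj₀ (norm_nonneg _) (by positivity) two_ne_zero).1 h

end Gradient

/-! ### The lower bound for the noisy gradient map -/

section LowerBound

variable {Ω : Type*} [MeasurableSpace Ω] {P : Measure Ω} {d m : ℕ}

lemma indepFun_pi_of_disjoint_range {ι α β : Type*} [Fintype α] [Fintype β]
    {f : ι → Ω → ℝ} (hf : iIndepFun f P) (hm : ∀ i, AEMeasurable (f i) P) (g : α → ι) (h : β → ι)
    (hgh : ∀ a b, g a ≠ h b) :
    IndepFun (fun ω a => f (g a) ω) (fun ω b => f (h b) ω) P := by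
  classical
  have hdisj : Disjoint (Finset.univ.image g) (Finset.univ.image h) := by
    rw [Finset.disjoint_left]
    intro i hi hi'
    obtain ⟨a, -, rfl⟩ := Finset.mem_image.1 hi
    obtain ⟨b, -, hb⟩ := Finset.mem_image.1 hi'
    exact hgh a b hb.symm
  exact (hf.indepFun_finset₀ _ _ hdisj hm).comp
    (φ := fun (x : Finset.univ.image g → ℝ) a =>
      x ⟨g a, Finset.mem_image_of_mem g (Finset.mem_univ a)⟩)
    (ψ := fun (x : Finset.univ.image h → ℝ) b =>
      x ⟨h b, Finset.mem_image_of_mem h (Finset.mem_univ b)⟩)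
    (by fun_prop) (by fun_prop)

lemma half_le_measureReal_of_compl [IsProbabilityMeasure P] {S T : Set Ω} (hS : P.real S ≤ 1 / 2)
    (h : Sᶜ ⊆ T) :
    1 / 2 ≤ P.real T := by
  have htot : (1 : ℝ) ≤ P.real S + P.real Sᶜ := by
    rw [← probReal_univ (μ := P), ← Set.union_compl_self S]
    exact measureReal_union_le _ _
  have := measureReal_mono (μ := P) h
  linarith

lemma mul_sqrt_le_of_sq {c v y : ℝ} (hv : 0 ≤ v) (hy : 0 ≤ y) (h : c ^ 2 * v ≤ y ^ 2) :
    c * √v ≤ y := by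
  apply le_of_abs_le
  apply abs_le_of_sq_le_sq _ hy
  rwa [mul_pow, Real.sq_sqrt hv]

variable {p σ : ℝ} {A : Fin m → Ω → Matrix (Fin d) (Fin d) ℝ} {s : Fin m → Ω → ℝ}

namespace GaussianNoisyModel

lemma aemeasurable (h : GaussianNoisyModel P p σ A s) (i) :
    AEMeasurable (Sum.elim (fun (q : Fin m × Fin d × Fin d) (ω : Ω) => A q.1 ω q.2.1 q.2.2) s i)
      P := by
  rcases i with q | i
  · exact (h.entry_law q.1 q.2.1 q.2.2).aemeasurable
  · exact (h.noise_law i).aemeasurable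

lemma iIndepFun_entry (h : GaussianNoisyModel P p σ A s) :
    iIndepFun (fun (q : Fin m × Fin d × Fin d) ω => A q.1 ω q.2.1 q.2.2) P :=
  h.indep.precomp (g := Sum.inl) Sum.inl_injective

lemma iIndepFun_noise (h : GaussianNoisyModel P p σ A s) : iIndepFun s P :=
  h.indep.precomp (g := Sum.inr) Sum.inr_injective

variable [IsProbabilityMeasure P]

/-- The pure noise term `(1/m) ∑ᵢ sᵢ Aᵢ` has at least the expected order of magnitude. -/
lemma half_le_measureReal_noise (h : GaussianNoisyModel P p σ A s) (hd : 0 < d) (hp : 0 ≤ p)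
    (hp1 : p ≤ 1) (hσ : 0 < σ) (hpm : 1 ≤ p * m) :
    1 / 2 ≤ P.real {ω | 1 / 40000000 * (p * σ ^ 2 * d ^ 2 / m) ≤
      ‖noisyGradientMap (fun i => A i ω) (fun i => s i ω) 0‖ ^ 2} := by
  have hm : (0 : ℝ) < m := by
    rcases Nat.eq_zero_or_pos m with rfl | hm
    · norm_num at hpm
    · exact_mod_cast hm
  have : Nonempty (Fin d × Fin d) := ⟨(⟨0, hd⟩, ⟨0, hd⟩)⟩
  have h1 := measureReal_sum_sq_noise_le hp hp1 hσ (by rwa [Fintype.card_fin]) h.noise_law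
    h.iIndepFun_noise
  rw [Fintype.card_fin] at h1
  have h2 := measureReal_sum_sq_sum_mul_gaussian_le (κ := Fin d × Fin d)
    (G := fun q i ω => A i ω q.1 q.2) (u := s) (fun q i => h.entry_law i q.1 q.2)
    (h.iIndepFun_entry.precomp (g := fun x : (Fin d × Fin d) × Fin m => (x.2, x.1))
      fun x y hxy => Prod.ext (Prod.mk.inj hxy).2 (Prod.mk.inj hxy).1)
    (fun i => (h.noise_law i).aemeasurable)
    (indepFun_pi_of_disjoint_range h.indep h.aemeasurable Sum.inr
      (fun x : (Fin d × Fin d) × Fin m => Sum.inl (x.2, x.1)) (by simp))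
    (a := (1 / 20000) * (p * m) * σ ^ 2) (by positivity)
  refine half_le_measureReal_of_compl (h2.trans (by linarith)) fun ω hω => ?_
  rw [Set.mem_compl_iff, Set.mem_ofPred_eq, not_le, Fintype.card_prod, Fintype.card_fin,
    Nat.cast_mul] at hω
  rw [Set.mem_ofPred_eq]
  rw [norm_noise_sq]
  calc 1 / 40000000 * (p * σ ^ 2 * d ^ 2 / m)
      = (1 / (m : ℝ)) ^ 2 * (1 / 2000 * (d * d) * (1 / 20000 * (p * m) * σ ^ 2)) := by
        field_simp
        ring
    _ ≤ _ := by gcongr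

/-- In dimension at least two, the correlations of one entry of the `Aᵢ` with all the others make
the noiseless error large. -/
lemma half_le_measureReal_noiseless (h : GaussianNoisyModel P p σ A s) (hm : 0 < m) (hd : 2 ≤ d)
    (e : Fin d × Fin d) :
    1 / 2 ≤ P.real {ω | 1 / 8000000 * ((d : ℝ) ^ 2 / m) ≤
      ‖noisyGradientMap (fun i => A i ω) 0 (Matrix.single e.1 e.2 1) -
        Matrix.single e.1 e.2 1‖ ^ 2} := by
  have hm' : (0 : ℝ) < m := by exact_mod_cast hm
  have : Nonempty (Fin m) := ⟨⟨0, hm⟩⟩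
  have hcard : Fintype.card {q : Fin d × Fin d // q ≠ e} = d * d - 1 := by
    rw [Fintype.card_subtype_compl, Fintype.card_prod, Fintype.card_fin]
    simp
  have hdd : 4 ≤ d * d := Nat.mul_le_mul hd hd
  have : Nonempty {q : Fin d × Fin d // q ≠ e} := by
    rw [← Fintype.card_pos_iff, hcard]
    omega
  have h1 := measureReal_sum_sq_gaussian_le one_ne_zero (fun i => h.entry_law i e.1 e.2)
    (h.iIndepFun_entry.precomp (g := fun i : Fin m => (i, e.1, e.2))
      fun x y hxy => (Prod.mk.inj hxy).1)
  rw [Fintype.card_fin, NNReal.coe_one, mul_one] at h1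
  have h2 := measureReal_sum_sq_sum_mul_gaussian_le (κ := {q : Fin d × Fin d // q ≠ e})
    (G := fun q i ω => A i ω q.1.1 q.1.2) (u := fun i ω => A i ω e.1 e.2)
    (fun q i => h.entry_law i q.1.1 q.1.2)
    (h.iIndepFun_entry.precomp
      (g := fun x : {q : Fin d × Fin d // q ≠ e} × Fin m => (x.2, x.1.1))
      fun x y hxy => Prod.ext (Subtype.ext (Prod.mk.inj hxy).2) (Prod.mk.inj hxy).1)
    (fun i => (h.entry_law i e.1 e.2).aemeasurable)
    (indepFun_pi_of_disjoint_range h.indep h.aemeasurable (fun i => Sum.inl (i, e))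
      (fun x : {q : Fin d × Fin d // q ≠ e} × Fin m => Sum.inl (x.2, x.1.1))
      (fun i x hx => x.1.2 (Prod.mk.inj (Sum.inl_injective hx)).2.symm))
    (a := (1 / 2000) * m) (by positivity)
  refine half_le_measureReal_of_compl (h2.trans (by linarith)) fun ω hω => ?_
  rw [Set.mem_compl_iff, Set.mem_ofPred_eq, not_le, hcard] at hω
  refine le_trans ?_ (sum_sq_le_norm_noiseless_sq (fun i => A i ω) e)
  have hc : (d : ℝ) ^ 2 / 2 ≤ ((d * d - 1 : ℕ) : ℝ) := by
    rw [Nat.cast_sub (by omega)]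
    have : (4 : ℝ) ≤ d * d := by exact_mod_cast hdd
    push_cast
    nlinarith
  calc 1 / 8000000 * ((d : ℝ) ^ 2 / m)
      = (1 / (m : ℝ)) ^ 2 * (1 / 2000 * ((d : ℝ) ^ 2 / 2) * (1 / 2000 * m)) := by
        field_simp
        norm_num
    _ ≤ (1 / (m : ℝ)) ^ 2 * (1 / 2000 * ((d * d - 1 : ℕ) : ℝ) * (1 / 2000 * m)) := by gcongr
    _ ≤ _ := by gcongr

lemma half_le_measureReal_noiseless_one_dim {A : Fin m → Ω → Matrix (Fin 1) (Fin 1) ℝ}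
    (h : GaussianNoisyModel P p σ A s) (hm : 0 < m) {c : ℝ} (hc0 : 0 ≤ c)
    (hc : (Measure.pi fun _ : Fin m => gaussianReal 0 1)
      {x | |∑ i, x i ^ 2 - m| ≤ c * √m} ≤ 1 / 2) :
    1 / 2 ≤ P.real {ω | c ^ 2 * (1 / (m : ℝ)) ≤
      ‖noisyGradientMap (fun i => A i ω) 0 (Matrix.single 0 0 1) - Matrix.single 0 0 1‖ ^ 2} := by
  have hm' : (0 : ℝ) < m := by exact_mod_cast hm
  have hlaw : HasLaw (fun ω (i : Fin m) => A i ω 0 0)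
      (Measure.pi fun _ : Fin m => gaussianReal 0 1) P :=
    (h.iIndepFun_entry.precomp (g := fun i : Fin m => (i, 0, 0))
      fun x y hxy => (Prod.mk.inj hxy).1).hasLaw_pi fun i => h.entry_law i 0 0
  have h1 := hlaw.measure_eq (p := fun x => |∑ i, x i ^ 2 - m| ≤ c * √m)
    (measurableSet_le (by fun_prop) (by fun_prop))
  have h2 : P.real {ω | |∑ i, A i ω 0 0 ^ 2 - m| ≤ c * √m} ≤ 1 / 2 := by
    refine ENNReal.toReal_le_of_le_ofReal (by norm_num) ?_
    rw [h1]
    refine hc.trans_eq ?_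
    rw [ENNReal.ofReal_div_of_pos two_pos]
    simp
  refine half_le_measureReal_of_compl h2 fun ω hω => ?_
  rw [Set.mem_compl_iff, Set.mem_ofPred_eq, not_le] at hω
  rw [Set.mem_ofPred_eq]
  rw [norm_noiseless_one_dim hm, div_pow]
  calc c ^ 2 * (1 / (m : ℝ)) = (c * √m) ^ 2 / (m : ℝ) ^ 2 := by
        rw [mul_pow, Real.sq_sqrt hm'.le]
        field_simp
    _ ≤ _ := by gcongr

end GaussianNoisyModel

end LowerBound

theorem mainTheorem6 :
    ∃ C₀ C₁ c₁ c₂ : ℝ, 0 < C₀ ∧ 0 < C₁ ∧ 0 < c₁ ∧ 0 < c₂ ∧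
      ∀ (d m : ℕ) (p σ : ℝ), 0 < d → 0 < m → 0 ≤ p → p ≤ 1 → 0 ≤ σ →
      ∀ (Ω : Type*) [MeasurableSpace Ω] (P : Measure Ω) [IsProbabilityMeasure P]
        (A : Fin m → Ω → Matrix (Fin d) (Fin d) ℝ) (s : Fin m → Ω → ℝ),
        GaussianNoisyModel P p σ A s →
        (∀ δ : ℝ, 0 < δ → δ < 1 → C₀ * ((d : ℝ) ^ 2 / δ ^ 2) ≤ (m : ℝ) →
          1 - C₁ * Real.exp (-(c₁ * (m : ℝ) * δ ^ 2)) ≤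
            P.real {ω | L2RIP (fun i => A i ω) d δ}) ∧
        ((1 ≤ p * (m : ℝ) ∨ p * σ ^ 2 ≤ 1) →
          1 / 2 ≤ P.real {ω |
            c₂ * Real.sqrt ((1 + p * σ ^ 2) * (d : ℝ) ^ 2 / (m : ℝ)) ≤
              ⨆ X : unitRankSphere d d,
                ‖noisyGradientMap (fun i => A i ω) (fun i => s i ω) X.1 - X.1‖}) := by
  obtain ⟨c, hc0, hc⟩ := exists_chiSq_anticoncentration
  -- `10⁻⁴` suits the bounds for the noise and for dimension at least two, `c / 2` dimension one
  refine ⟨50000, 2, 3 / 65536, min (1 / 10000) (c / 2), by norm_num, by norm_num, by norm_num,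
    by positivity, ?_⟩
  intro d m p σ hd hm hp hp1 hσ Ω _ P _ A s h
  refine ⟨fun δ hδ hδ1 hmd => one_sub_le_measureReal_L2RIP hm h.entry_law h.iIndepFun_entry hδ hδ1
    hmd, fun hcase => ?_⟩
  have hm' : (0 : ℝ) < m := by exact_mod_cast hm
  set c₂ : ℝ := min (1 / 10000) (c / 2) with hc₂
  have hc₂0 : 0 ≤ c₂ := by positivity
  have hc₂1 : c₂ ^ 2 ≤ (1 / 10000) ^ 2 := by gcongr; exact min_le_left _ _
  have hc₂2 : c₂ ^ 2 ≤ (c / 2) ^ 2 := by gcongr; exact min_le_right _ _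
  have hv : 0 ≤ (1 + p * σ ^ 2) * (d : ℝ) ^ 2 / m := by positivity
  have hdm : 0 ≤ (d : ℝ) ^ 2 / m := by positivity
  have hsplit : (1 + p * σ ^ 2) * (d : ℝ) ^ 2 / m =
      (d : ℝ) ^ 2 / m + p * σ ^ 2 * (d : ℝ) ^ 2 / m := by ring
  have hX : ‖(Matrix.single ⟨0, hd⟩ ⟨0, hd⟩ 1 : Matrix (Fin d) (Fin d) ℝ)‖ = 1 :=
    norm_single_one _ _
  rcases le_or_gt (p * σ ^ 2) 1 with hpσ | hpσ
  · -- small noise: the noiseless error already has the required size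
    have hv2 : (1 + p * σ ^ 2) * (d : ℝ) ^ 2 / m ≤ 2 * ((d : ℝ) ^ 2 / m) := by
      rw [mul_div_assoc]
      gcongr
      linarith
    rcases Nat.lt_or_ge 1 d with hd2 | hd1
    · refine (h.half_le_measureReal_noiseless hm hd2 (⟨0, hd⟩, ⟨0, hd⟩)).trans
        (measureReal_mono fun ω hω => ?_)
      refine (mul_sqrt_le_of_sq hv (norm_nonneg _) (le_trans ?_ hω)).trans
        (norm_noise_le_iSup_and_norm_noiseless_le_iSup _ _ hX).2
      calc c₂ ^ 2 * ((1 + p * σ ^ 2) * (d : ℝ) ^ 2 / m)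
          ≤ (1 / 10000) ^ 2 * (2 * ((d : ℝ) ^ 2 / m)) := by gcongr
        _ ≤ 1 / 8000000 * ((d : ℝ) ^ 2 / m) := by linarith
    · obtain rfl : d = 1 := by omega
      refine (h.half_le_measureReal_noiseless_one_dim hm hc0.le (hc m hm)).trans
        (measureReal_mono fun ω hω => ?_)
      refine (mul_sqrt_le_of_sq hv (norm_nonneg _) (le_trans ?_ hω)).trans
        (norm_noise_le_iSup_and_norm_noiseless_le_iSup _ _ hX).2
      calc c₂ ^ 2 * ((1 + p * σ ^ 2) * ((1 : ℕ) : ℝ) ^ 2 / m)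
          ≤ (c / 2) ^ 2 * (2 * (((1 : ℕ) : ℝ) ^ 2 / m)) := by gcongr
        _ ≤ c ^ 2 * (1 / (m : ℝ)) := by
          rw [Nat.cast_one, one_pow]
          have : 0 ≤ c ^ 2 * (1 / (m : ℝ)) := by positivity
          linarith
  · -- large noise: the pure noise term has the required size
    have hpm := hcase.resolve_right (not_le.2 hpσ)
    have hσ0 : 0 < σ := by
      rcases hσ.eq_or_lt with rfl | h0
      · norm_num at hpσ
      · exact h0
    have hv2 : (1 + p * σ ^ 2) * (d : ℝ) ^ 2 / m ≤ 2 * (p * σ ^ 2 * (d : ℝ) ^ 2 / m) := by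
      rw [mul_div_assoc, mul_div_assoc, ← mul_assoc]
      gcongr
      linarith
    have hpos : 0 ≤ p * σ ^ 2 * (d : ℝ) ^ 2 / m := by positivity
    refine (h.half_le_measureReal_noise hd hp hp1 hσ0 hpm).trans
      (measureReal_mono fun ω hω => ?_)
    refine (mul_sqrt_le_of_sq hv (norm_nonneg _) (le_trans ?_ hω)).trans
      (norm_noise_le_iSup_and_norm_noiseless_le_iSup _ _ hX).1
    calc c₂ ^ 2 * ((1 + p * σ ^ 2) * (d : ℝ) ^ 2 / m)
        ≤ (1 / 10000) ^ 2 * (2 * (p * σ ^ 2 * (d : ℝ) ^ 2 / m)) := by gcongr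
      _ ≤ 1 / 40000000 * (p * σ ^ 2 * (d : ℝ) ^ 2 / m) := by linarith
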